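/- Definitions. Let $H$ be a simple graph. A weighted blow-up graph of $H$ is obtained by replacing each vertex $v$ of $H$ by a finite cluster $A_v$, joining some pairs $x\in A_u$, $y\in A_v$ with $uv\in E(H)$ (and no other pairs), and giving each new vertex $x$ a weight $w(x)\ge 0$ such that each cluster has total weight $1$. The density between $A_u$ and $A_v$ is $d(A_u,A_v)=\sum w(x)w(y)$, summed over all edges $xy$ with $x\in A_u$, $y\in A_v$. The blow-up graph contains $H$ as a transversal if one can choose $\varphi(v)\in A_v$ for all $v\in V(H)$ so that $\varphi(u)\varphi(v)$ is an edge whenever $uv\in E(H)$. Real numbers $\gamma_e$ $(e\in E(H))$ ensure the existence of $H$ if every weighted blow-up graph of $H$ with $d(A_u,A_v)\ge\gamma_{uv}$ for all $uv\in E(H)$ contains $H$ as a transversal. Let $H$ have $n$ vertices. A proper labeling of $H$ is a bijection $f:\{1,\dots,n\}\to V(H)$ such that $\{f(1),\dots,f(k)\}$ induces a connected subgraph of $H$ for all $1\le k\le n$. The monotone-path tree $T_f(H)$ has as its vertices the paths $f(i_1)f(i_2)\dots f(i_k)$ of $H$ with $1=i_1<i_2<\dots<i_k$, two of them being adjacent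 if one is the extension of the other with exactly one new vertex. If $H$ has edge weights $\gamma_e$, then the edge of $T_f(H)$ joining $f(i_1)\dots f(i_{k-1})$ and $f(i_1)\dots f(i_k)$ gets the weight of the edge $f(i_{k-1})f(i_k)$ of $H$. Theorem 5.8. The General Star Decomposition Conjecture holds for the cycle $C_n$, for every $n\ge 3$. That is, let $\gamma_e\in[0,1]$ be given for each edge $e$ of $C_n$, and assume that for each proper labeling $f$ of $C_n$ the weights of the weighted monotone-path tree $T_f(C_n)$, taken as densities, ensure the existence of $T_f(C_n)$. Then the densities $\gamma_e$ ensure the existence of $C_n$. Moreover, for each proper labeling $f$ of $C_n$ the tree $T_f(C_n)$ is a path on $n+1$ vertices. -/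

import Mathlib

namespace DensityTuran

/-- A weighted blow-up graph of `H`: each vertex `v` of `H` is replaced by a finite cluster,
edges are only allowed between clusters of adjacent vertices of `H`, the vertices carry
non-negative weights, and each cluster has total weight `1`. -/
structure WeightedBlowup {V : Type*} (H : SimpleGraph V) where
  /-- The cluster replacing a vertex. -/
  Cluster : V → Type
  /-- Clusters are finite. -/
  [fintypeCluster : ∀ v, Fintype (Cluster v)]
  /-- The blow-up graph, on the disjoint union of the clusters. -/
  graph : SimpleGraph (Σ v, Cluster v)
  /-- Edges lie over edges of `H`. -/
  adj_of_adj : ∀ x y, graph.Adj x y → H.Adj x.1 y.1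
  /-- The weight of a vertex of the blow-up graph. -/
  weight : (Σ v, Cluster v) → ℝ
  weight_nonneg : ∀ x, 0 ≤ weight x
  sum_weight : ∀ v, ∑ a : Cluster v, weight ⟨v, a⟩ = 1

attribute [instance] WeightedBlowup.fintypeCluster

namespace WeightedBlowup

open Classical in
/-- The density between the clusters of `u` and `v`: the sum of `w(x) w(y)` over all edges
`(x, y)` of the blow-up graph with `x` in the cluster of `u` and `y` in the cluster of `v`. -/
noncomputable def density {V : Type*} {H : SimpleGraph V} (B : WeightedBlowup H) (u v : V) : ℝ :=
  ∑ a : B.Cluster u, ∑ b : B.Cluster v,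
    if B.graph.Adj ⟨u, a⟩ ⟨v, b⟩ then B.weight ⟨u, a⟩ * B.weight ⟨v, b⟩ else 0

/-- `H` is a transversal (a factor) of the blow-up graph: one can choose a vertex from each
cluster so that adjacent vertices of `H` give adjacent chosen vertices. -/
def HasTransversal {V : Type*} {H : SimpleGraph V} (B : WeightedBlowup H) : Prop :=
  ∃ φ : ∀ v, B.Cluster v, ∀ u v, H.Adj u v → B.graph.Adj ⟨u, φ u⟩ ⟨v, φ v⟩

end WeightedBlowup

/-- The densities `γ` (of which only the values on edges of `H` matter) ensure the existence of
`H`: every weighted blow-up graph of `H` all of whose densities are at least the prescribed ones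
contains `H` as a transversal. -/
def Ensures {V : Type*} (H : SimpleGraph V) (γ : Sym2 V → ℝ) : Prop :=
  ∀ B : WeightedBlowup H, (∀ u v, H.Adj u v → γ s(u, v) ≤ B.density u v) → B.HasTransversal

/-- A proper labeling of the vertices of `H`: every nonempty initial segment
`f '' {i | i ≤ k}` induces a connected subgraph. -/
def IsProperLabeling {V : Type*} {n : ℕ} (H : SimpleGraph V) (f : Fin n ≃ V) : Prop :=
  ∀ k : Fin n, (H.induce (f '' Set.Iic k)).Connected

/-- A monotone path `f(i₁) f(i₂) … f(iₖ)` of `H`, where `i₁ < i₂ < … < iₖ` and `i₁` is the first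
label (which is `0` in `Fin n`), given by the list of its labels. -/
structure MonotonePath {V : Type*} {n : ℕ} (H : SimpleGraph V) (f : Fin n ≃ V) where
  labels : List (Fin n)
  labels_ne_nil : labels ≠ []
  head_eq_zero : (labels.head labels_ne_nil).val = 0
  isChain : labels.IsChain (fun i j => i < j ∧ H.Adj (f i) (f j))

/-- The last vertex of a monotone path. -/
def MonotonePath.lastVertex {V : Type*} {n : ℕ} {H : SimpleGraph V} {f : Fin n ≃ V}
    (p : MonotonePath H f) : V :=
  f (p.labels.getLast p.labels_ne_nil)

/-- The monotone-path tree `T_f(H)`: its vertices are the monotone paths, and two of them are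
adjacent if one is the extension of the other with exactly one new vertex. -/
def monotonePathTree {V : Type*} {n : ℕ} (H : SimpleGraph V) (f : Fin n ≃ V) :
    SimpleGraph (MonotonePath H f) where
  Adj p q := (∃ i, q.labels = p.labels ++ [i]) ∨ (∃ i, p.labels = q.labels ++ [i])
  symm := ⟨fun _ _ h => h.symm⟩
  loopless := ⟨fun p h => by
    rcases h with ⟨i, hi⟩ | ⟨i, hi⟩ <;> simpa using congrArg List.length hi⟩

/-- The weights of the monotone-path tree: the edge joining `f(i₁) … f(iₖ₋₁)` and
`f(i₁) … f(iₖ)` gets the weight of the edge `f(iₖ₋₁) f(iₖ)` of `H`, which joins the last vertices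
of the two paths. -/
def monotonePathTreeWeight {V : Type*} {n : ℕ} (H : SimpleGraph V) (f : Fin n ≃ V)
    (γ : Sym2 V → ℝ) : Sym2 (MonotonePath H f) → ℝ :=
  fun e => γ (e.map MonotonePath.lastVertex)

/-- The General Star Decomposition Conjecture for the graph `H` on `n` labeled vertices: for all
edge densities in `[0, 1]`, if for each proper labeling `f` the weights of the weighted
monotone-path tree ensure the existence of `T_f(H)`, then the densities ensure the existence
of `H`. -/
def GeneralStarDecomposition {n : ℕ} (H : SimpleGraph (Fin n)) : Prop :=
  ∀ γ : Sym2 (Fin n) → ℝ, (∀ e ∈ H.edgeSet, 0 ≤ γ e ∧ γ e ≤ 1) →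
    (∀ f : Fin n ≃ Fin n, IsProperLabeling H f →
      Ensures (monotonePathTree H f) (monotonePathTreeWeight H f γ)) →
    Ensures H γ

end DensityTuran

/-! Cut the cycle at the last vertex `v` of a proper labeling. Every earlier initial segment is an
arc avoiding `v`, so the monotone paths are exactly the arcs growing in either direction from the
first vertex as far as `v`. The tree is therefore the cycle opened at `v`, a path whose two ends
both lie over `v` (`IsProperLabeling.exists_iso`).

Suppose the densities fail for the cycle and take a counterexample with the fewest vertices. Weights
within one cluster can be moved linearly until one vanishes. With only two neighbouring clusters to
respect, minimality leaves at most two vertices per cluster. A one-vertex cluster is impossible: the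
path obtained by cutting there has a transversal, and its two ends agree. So each cluster is a pair
`L`, `R`, of weights `q` and `p`, with `R` better connected forwards and `L` backwards.

Between consecutive clusters only two kinds of adjacency survive (`adjacency_cases`): parallel, with
`LL` and `RR` present and `LR` absent, or crossing. All parallel would make the choice of every `L`
a transversal, so some pair crosses. If two cross, or if one crosses without `LR`, the weights of
the counterexample yield a two-vertex-per-cluster blow-up of a cut path without a transversal,
contradicting the hypothesis (`false_of_certificate`). If one crosses with `LR`, a transversal of
the cycle is written down directly. -/

namespace DensityTuran

/-! ### Walking around the cycle -/

/-- The vertex of the cycle reached from `v` after `k` steps in the positive direction. -/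
def rot {n : ℕ} (v : Fin n) (k : ℕ) : Fin n := ⟨(v.val + k) % n, Nat.mod_lt _ v.pos⟩

section rot

variable {n : ℕ}

theorem rot_zero (v : Fin n) : rot v 0 = v := by
  ext; simp [rot, Nat.mod_eq_of_lt v.isLt]

theorem rot_self (v : Fin n) : rot v n = v := by
  ext; simp [rot, Nat.mod_eq_of_lt v.isLt]

theorem rot_rot (v : Fin n) (k l : ℕ) : rot (rot v k) l = rot v (k + l) := by
  ext; simp [rot, Nat.add_assoc]

theorem rot_inj {v : Fin n} {k l : ℕ} (hk : k < n) (hl : l < n) (h : rot v k = rot v l) :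
    k = l := by
  have h1 : (v.val + k) % n = (v.val + l) % n := congrArg Fin.val h
  have h2 : k ≡ l [MOD n] := Nat.ModEq.add_left_cancel' v.val h1
  exact Nat.ModEq.eq_of_lt_of_lt h2 hk hl

theorem rot_left_injective (k : ℕ) : Function.Injective (fun v : Fin n => rot v k) := by
  intro v w h
  have h1 : (v.val + k) % n = (w.val + k) % n := congrArg Fin.val h
  have h2 : v.val ≡ w.val [MOD n] := Nat.ModEq.add_right_cancel' k h1
  exact Fin.ext (Nat.ModEq.eq_of_lt_of_lt h2 v.isLt w.isLt)

theorem exists_rot (v w : Fin n) : ∃ k < n, w = rot v k := by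
  have hv := v.isLt
  have hw := w.isLt
  by_cases h : v.val ≤ w.val
  · refine ⟨w.val - v.val, by omega, ?_⟩
    ext
    simp only [rot]
    rw [Nat.add_sub_cancel' h, Nat.mod_eq_of_lt hw]
  · refine ⟨w.val + n - v.val, by omega, ?_⟩
    ext
    simp only [rot]
    rw [Nat.add_sub_cancel' (by omega), Nat.add_mod_right, Nat.mod_eq_of_lt hw]

theorem cycleGraph_adj_iff (hn : 3 ≤ n) (u v : Fin n) :
    (SimpleGraph.cycleGraph n).Adj u v ↔ v = rot u 1 ∨ u = rot v 1 := by
  have key : ∀ u v : Fin n, (u - v).val = 1 ↔ u = rot v 1 := by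
    intro u v
    have hv := v.isLt
    have hu := u.isLt
    rw [Fin.ext_iff, Fin.val_sub]
    simp only [rot]
    by_cases h : v.val ≤ u.val
    · have : (n - v.val + u.val) % n = u.val - v.val := by
        rw [show n - v.val + u.val = (u.val - v.val) + n by omega, Nat.add_mod_right,
          Nat.mod_eq_of_lt (by omega)]
      rw [this]
      by_cases h2 : v.val + 1 < n
      · rw [Nat.mod_eq_of_lt h2]; omega
      · rw [show v.val + 1 = n by omega, Nat.mod_self]; omega
    · rw [Nat.mod_eq_of_lt (by omega)]
      by_cases h2 : v.val + 1 < n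
      · rw [Nat.mod_eq_of_lt h2]; omega
      · rw [show v.val + 1 = n by omega, Nat.mod_self]; omega
  rw [SimpleGraph.cycleGraph_adj', key, key, or_comm]

theorem cycleGraph_adj_rot (hn : 3 ≤ n) (v : Fin n) (k : ℕ) :
    (SimpleGraph.cycleGraph n).Adj (rot v k) (rot v (k + 1)) :=
  (cycleGraph_adj_iff hn _ _).2 (Or.inl (rot_rot v k 1).symm)

/-- The neighbours of `v + k` are `v + k + 1` and `v + k - 1`. -/
theorem eq_rot_of_adj (hn : 3 ≤ n) {v w : Fin n} {k : ℕ} (hk : 0 < k)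
    (h : (SimpleGraph.cycleGraph n).Adj (rot v k) w) : w = rot v (k + 1) ∨ w = rot v (k - 1) := by
  rcases (cycleGraph_adj_iff hn _ _).1 h with h | h
  · left; rw [h, rot_rot]
  · right
    apply rot_left_injective 1
    simp only
    rw [← h, rot_rot, Nat.sub_add_cancel hk]

end rot

/-- Used below as a separation argument: a property preserved along edges cannot hold at only one
end of a connection. -/
theorem of_reachable {V : Type*} {G : SimpleGraph V} {P : V → Prop}
    (h : ∀ x y, G.Adj x y → P x → P y) {x y : V} (hxy : G.Reachable x y) (hx : P x) : P y := by
  obtain ⟨p⟩ := hxy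
  induction p with
  | nil => exact hx
  | cons hadj _ ih => exact ih (h _ _ hadj hx)

/-! ### Proper labelings of a cycle -/

section labeling

variable {n : ℕ} {f : Fin n ≃ Fin n}

/-- The initial segments of a proper labeling of a cycle are arcs: walking away from the first
vertex in the positive direction, the labels increase until the last vertex is reached. -/
theorem IsProperLabeling.label_lt_succ (hn : 3 ≤ n)
    (hf : IsProperLabeling (SimpleGraph.cycleGraph n) f) {v : Fin n}
    (hv : (f.symm v).val = n - 1) {c : ℕ} (hc : 0 < c) (hcn : c < n)
    (hfc : (f.symm (rot v c)).val = 0) {k : ℕ} (hck : c ≤ k) (hkn : k < n) :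
    f.symm (rot v k) < f.symm (rot v (k + 1)) := by
  by_contra hlt
  rw [not_lt] at hlt
  have hne : ∀ {i j : ℕ}, i < n → j < n → i ≠ j → f.symm (rot v i) ≠ f.symm (rot v j) :=
    fun hi hj hij h => hij (rot_inj hi hj (f.symm.injective h))
  have hle : ∀ x : Fin n, x.val ≤ n - 1 := fun x => by omega
  rcases Nat.lt_or_ge (k + 1) n with hk1 | hk1
  · have hlt' : f.symm (rot v (k + 1)) < f.symm (rot v k) :=
      lt_of_le_of_ne hlt (hne hk1 hkn (by omega))
    have hkc : k ≠ c := by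
      rintro rfl
      rw [Fin.lt_def, hfc] at hlt'
      exact absurd hlt' (Nat.not_lt_zero _)
    -- This initial segment would miss both `v` and `v + k`, which separate `v + c` from `v + k + 1`
    -- on the cycle, so it could not be connected.
    set S := f '' Set.Iic (f.symm (rot v (k + 1))) with hS
    have hmem : ∀ x, x ∈ S ↔ f.symm x ≤ f.symm (rot v (k + 1)) := by
      intro x
      rw [hS, f.image_eq_preimage_symm]; rfl
    have hcS : rot v c ∈ S := by rw [hmem, Fin.le_def, hfc]; exact Nat.zero_le _
    have hkS : rot v (k + 1) ∈ S := (hmem _).2 le_rfl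
    have hnk : rot v k ∉ S := by rw [hmem, not_le]; exact hlt'
    have hnv : v ∉ S := by
      rw [hmem, not_le, Fin.lt_def, hv]
      exact lt_of_lt_of_le hlt' (hle _)
    have hconn := (hf (f.symm (rot v (k + 1)))).preconnected ⟨_, hcS⟩ ⟨_, hkS⟩
    obtain ⟨j, hj, hj'⟩ := of_reachable (P := fun x : S => ∃ j < k, x.1 = rot v j) (by
      rintro ⟨x, hx⟩ ⟨y, hy⟩ hxy ⟨j, hj, rfl⟩
      rcases Nat.eq_zero_or_pos j with rfl | hj0
      · rw [rot_zero] at hx; exact absurd hx hnv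
      · rcases eq_rot_of_adj hn hj0 hxy with h | h
        · refine ⟨j + 1, lt_of_le_of_ne hj ?_, h⟩
          intro hjk
          rw [hjk] at h
          exact hnk (h ▸ hy)
        · exact ⟨j - 1, by omega, h⟩) hconn ⟨c, by omega, rfl⟩
    have := rot_inj hk1 (by omega) hj'
    omega
  -- The walk has closed up: `rot v n` is `v`, which carries the largest label.
  · have hk1 : k + 1 = n := by omega
    rw [hk1, rot_self, Fin.le_def, hv] at hlt
    have h1 : f.symm (rot v k) = f.symm (rot v 0) := by
      rw [rot_zero]; ext; have := hle (f.symm (rot v k)); omega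
    exact hne hkn (by omega) (by omega) h1

/-- The mirror image of `IsProperLabeling.label_lt_succ`: if the inequality failed, an initial
segment would omit `v` and `v + k + 1`, which separate `v + k` from `v + c`. -/
theorem IsProperLabeling.label_succ_lt (hn : 3 ≤ n)
    (hf : IsProperLabeling (SimpleGraph.cycleGraph n) f) {v : Fin n}
    (hv : (f.symm v).val = n - 1) {c : ℕ} (hcn : c < n)
    (hfc : (f.symm (rot v c)).val = 0) {k : ℕ} (hkc : k < c) :
    f.symm (rot v (k + 1)) < f.symm (rot v k) := by
  by_contra hlt
  rw [not_lt] at hlt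
  have hne : ∀ {i j : ℕ}, i < n → j < n → i ≠ j → f.symm (rot v i) ≠ f.symm (rot v j) :=
    fun hi hj hij h => hij (rot_inj hi hj (f.symm.injective h))
  have hle : ∀ x : Fin n, x.val ≤ n - 1 := fun x => by omega
  have hlt' : f.symm (rot v k) < f.symm (rot v (k + 1)) :=
    lt_of_le_of_ne hlt (hne (by omega) (by omega) (by omega))
  have hkc' : k + 1 ≠ c := by
    rintro rfl
    rw [Fin.lt_def, hfc] at hlt'
    exact absurd hlt' (Nat.not_lt_zero _)
  set S := f '' Set.Iic (f.symm (rot v k)) with hS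
  have hmem : ∀ x, x ∈ S ↔ f.symm x ≤ f.symm (rot v k) := by
    intro x
    rw [hS, f.image_eq_preimage_symm]; rfl
  have hcS : rot v c ∈ S := by rw [hmem, Fin.le_def, hfc]; exact Nat.zero_le _
  have hkS : rot v k ∈ S := (hmem _).2 le_rfl
  have hnk : rot v (k + 1) ∉ S := by rw [hmem, not_le]; exact hlt'
  have hnv : v ∉ S := by
    rw [hmem, not_le, Fin.lt_def, hv]
    exact lt_of_lt_of_le hlt' (hle _)
  have hconn := (hf (f.symm (rot v k))).preconnected ⟨_, hcS⟩ ⟨_, hkS⟩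
  obtain ⟨j, hkj, hj, hj'⟩ :=
    of_reachable (P := fun x : S => ∃ j, k + 1 < j ∧ j < n ∧ x.1 = rot v j) (by
      rintro ⟨x, hx⟩ ⟨y, hy⟩ hxy ⟨j, hkj, hj, rfl⟩
      rcases eq_rot_of_adj hn (by omega) hxy with h | h
      · refine ⟨j + 1, by omega, lt_of_le_of_ne hj ?_, h⟩
        intro hjn
        rw [hjn, rot_self] at h
        exact hnv (h ▸ hy)
      · refine ⟨j - 1, lt_of_le_of_ne (by omega) ?_, by omega, h⟩
        intro hjk
        rw [← hjk] at h
        exact hnk (h ▸ hy)) hconn ⟨c, by omega, hcn, rfl⟩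
  have := rot_inj (by omega) hj hj'
  omega

/-- Every vertex of a cycle is the last one in some proper labeling. -/
theorem exists_isProperLabeling (hn : 3 ≤ n) (v : Fin n) :
    ∃ f : Fin n ≃ Fin n, IsProperLabeling (SimpleGraph.cycleGraph n) f ∧
      (f.symm v).val = n - 1 := by
  have hinj : Function.Injective (fun i : Fin n => rot (rot v 1) i.val) :=
    fun i j h => Fin.ext (rot_inj i.isLt j.isLt h)
  let f : Fin n ≃ Fin n := Equiv.ofBijective _ (Finite.injective_iff_bijective.1 hinj)
  have hf : ∀ i, f i = rot (rot v 1) i.val := fun i => rfl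
  refine ⟨f, ?_, ?_⟩
  · intro k
    have hmem : ∀ i : ℕ, i ≤ k.val → rot (rot v 1) i ∈ f '' Set.Iic k :=
      fun i hi => ⟨⟨i, lt_of_le_of_lt hi k.isLt⟩, hi, rfl⟩
    rw [SimpleGraph.connected_iff_exists_forall_reachable]
    refine ⟨⟨_, hmem 0 (Nat.zero_le _)⟩, ?_⟩
    rintro ⟨_, i, hi, rfl⟩
    have : ∀ i : ℕ, ∀ hi : i ≤ k.val,
        ((SimpleGraph.cycleGraph n).induce (f '' Set.Iic k)).Reachable
          ⟨_, hmem 0 (Nat.zero_le _)⟩ ⟨_, hmem i hi⟩ := by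
      intro i
      induction i with
      | zero => intro _; exact SimpleGraph.Reachable.refl _
      | succ i ih =>
        intro hi
        refine (ih (by omega)).trans (SimpleGraph.Adj.reachable ?_)
        exact cycleGraph_adj_rot hn (rot v 1) i
    exact this i.val hi
  · have : f.symm v = ⟨n - 1, by omega⟩ := by
      rw [Equiv.symm_apply_eq, hf, rot_rot, Nat.add_sub_cancel' (by omega), rot_self]
    rw [this]

end labeling

/-! ### Arcs as label lists, and the monotone-path tree as a path -/

section arcList

variable {α : Type*} (g : ℕ → α) (c : ℕ)

/-- The list of the values `g c, …, g k`, in the direction from `c` to `k`. -/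
def arcList (k : ℕ) : List α :=
  if c ≤ k then (List.range (k - c + 1)).map (fun j => g (c + j))
  else (List.range (c - k + 1)).map (fun j => g (c - j))

theorem arcList_self : arcList g c c = [g c] := by
  simp [arcList]

theorem arcList_succ {k : ℕ} (h : c ≤ k) :
    arcList g c (k + 1) = arcList g c k ++ [g (k + 1)] := by
  rw [arcList, arcList, if_pos h, if_pos (by omega), show k + 1 - c + 1 = (k - c + 1) + 1 by omega,
    List.range_succ (n := k - c + 1), List.map_append, List.map_singleton,
    show c + (k - c + 1) = k + 1 by omega]

theorem arcList_of_lt {k : ℕ} (h : k < c) :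
    arcList g c k = arcList g c (k + 1) ++ [g k] := by
  rw [arcList, if_neg (by omega), show c - k + 1 = (c - (k + 1) + 1) + 1 by omega,
    List.range_succ (n := c - (k + 1) + 1), List.map_append, List.map_singleton,
    show c - (c - (k + 1) + 1) = k by omega]
  congr 1
  by_cases hk : c = k + 1
  · subst hk; simp [arcList]
  · rw [arcList, if_neg (by omega)]

theorem arcList_ne_nil (k : ℕ) : arcList g c k ≠ [] := by
  unfold arcList; split_ifs <;> simp

theorem head?_arcList (k : ℕ) : (arcList g c k).head? = some (g c) := by
  unfold arcList; split_ifs <;> simp [List.range_succ_eq_map]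

theorem getLast?_arcList (k : ℕ) : (arcList g c k).getLast? = some (g k) := by
  rcases lt_trichotomy c k with h | rfl | h
  · obtain ⟨k, rfl⟩ : ∃ m, k = m + 1 := ⟨k - 1, by omega⟩
    rw [arcList_succ g c (by omega)]; simp
  · simp [arcList_self]
  · rw [arcList_of_lt g c h]; simp

/-- The last entry determines the arc, except that positions `0` and `n` are the same vertex of the
cycle. Those two arcs leave `c` in opposite directions, so their second entries differ. -/
theorem arcList_injOn {n : ℕ} (hc : 0 < c) (hcn : c < n)
    (hg : ∀ i ≤ n, ∀ j ≤ n, g i = g j → i = j ∨ (i = 0 ∧ j = n) ∨ (i = n ∧ j = 0))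
    (hne : g (c - 1) ≠ g (c + 1)) {k l : ℕ} (hk : k ≤ n) (hl : l ≤ n)
    (h : arcList g c k = arcList g c l) : k = l := by
  have h1 : g k = g l := by
    have := congrArg List.getLast? h
    rwa [getLast?_arcList, getLast?_arcList, Option.some_inj] at this
  have key : arcList g c 0 ≠ arcList g c n := by
    intro h
    have h2 := congrArg (fun l => l[1]?) h
    simp only [arcList] at h2
    rw [if_neg (by omega), if_pos hcn.le, List.getElem?_map, List.getElem?_map,
      List.getElem?_range (by omega), List.getElem?_range (by omega)] at h2
    exact hne (Option.some_inj.1 h2)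
  rcases hg k hk l hl h1 with h2 | ⟨rfl, rfl⟩ | ⟨rfl, rfl⟩
  · exact h2
  · exact absurd h key
  · exact absurd h.symm key

theorem isChain_arcList {R : α → α → Prop} {n : ℕ}
    (hup : ∀ k, c ≤ k → k < n → R (g k) (g (k + 1))) (hdown : ∀ k < c, R (g (k + 1)) (g k))
    {k : ℕ} (hk : k ≤ n) : (arcList g c k).IsChain R := by
  have happ : ∀ l x, (arcList g c l).IsChain R → R (g l) x → (arcList g c l ++ [x]).IsChain R := by
    intro l x h1 h2
    rw [List.isChain_append]
    refine ⟨h1, List.isChain_singleton _, ?_⟩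
    rw [getLast?_arcList]
    simpa using h2
  rcases le_total c k with h | h
  · induction k, h using Nat.le_induction with
    | base => rw [arcList_self]; exact List.isChain_singleton _
    | succ k hck ih =>
      rw [arcList_succ g c hck]
      exact happ _ _ (ih (by omega)) (hup k hck (by omega))
  · have : ∀ d ≤ c, (arcList g c (c - d)).IsChain R := by
      intro d
      induction d with
      | zero => intro _; rw [Nat.sub_zero, arcList_self]; exact List.isChain_singleton _
      | succ d ih =>
        intro hd
        rw [arcList_of_lt g c (by omega), show c - (d + 1) + 1 = c - d by omega]
        refine happ _ _ (ih (by omega)) ?_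
        have := hdown (c - (d + 1)) (by omega)
        rwa [show c - (d + 1) + 1 = c - d by omega] at this
    have h2 := this (c - k) (by omega)
    rwa [show c - (c - k) = k by omega] at h2

end arcList

theorem MonotonePath.ext_labels {V : Type*} {n : ℕ} {H : SimpleGraph V} {f : Fin n ≃ V}
    {p q : MonotonePath H f} (h : p.labels = q.labels) : p = q := by
  cases p; cases q; cases h; rfl

/-- For a proper labeling of a cycle, the monotone-path tree is the path obtained by cutting the
cycle at the last vertex. -/
theorem IsProperLabeling.exists_iso {n : ℕ} (hn : 3 ≤ n) {f : Fin n ≃ Fin n}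
    (hf : IsProperLabeling (SimpleGraph.cycleGraph n) f) {v : Fin n}
    (hv : (f.symm v).val = n - 1) :
    ∃ e : SimpleGraph.pathGraph (n + 1) ≃g monotonePathTree (SimpleGraph.cycleGraph n) f,
      ∀ k, (e k).lastVertex = rot v k.val := by
  set g : ℕ → Fin n := fun k => f.symm (rot v k) with hg
  have hfg : ∀ k, f (g k) = rot v k := fun k => f.apply_symm_apply _
  obtain ⟨c, hcn, hc⟩ := exists_rot v (f ⟨0, by omega⟩)
  have hgc : (g c).val = 0 := by simp only [hg]; rw [← hc, f.symm_apply_apply]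
  have hc0 : 0 < c := by
    rcases Nat.eq_zero_or_pos c with rfl | h
    · simp only [hg] at hgc
      rw [rot_zero, hv] at hgc
      omega
    · exact h
  have hup : ∀ k, c ≤ k → k < n → g k < g (k + 1) :=
    fun k h1 h2 => hf.label_lt_succ hn hv hc0 hcn hgc h1 h2
  have hdown : ∀ k < c, g (k + 1) < g k := fun k h1 => hf.label_succ_lt hn hv hcn hgc h1
  have hgn : ∀ x : Fin n, x ≤ g n := by
    intro x
    simp only [hg]
    rw [rot_self, Fin.le_def, hv]
    omega
  have hg0 : g 0 = g n := by simp only [hg]; rw [rot_self, rot_zero]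
  have hginj : ∀ i ≤ n, ∀ j ≤ n, g i = g j → i = j ∨ (i = 0 ∧ j = n) ∨ (i = n ∧ j = 0) := by
    intro i hi j hj hij
    have hij : rot v i = rot v j := f.symm.injective hij
    rcases hi.eq_or_lt with rfl | hi
    · rcases hj.eq_or_lt with rfl | hj
      · exact Or.inl rfl
      · rw [rot_self, ← rot_zero v, rot_rot] at hij
        have := rot_inj (by omega) (by omega) hij
        omega
    · rcases hj.eq_or_lt with rfl | hj
      · rw [rot_self] at hij
        have := rot_inj (l := 0) hi (by omega) (hij.trans (rot_zero v).symm)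
        omega
      · exact Or.inl (rot_inj hi hj hij)
  have hne : g (c - 1) ≠ g (c + 1) := by
    intro h
    have := hginj (c - 1) (by omega) (c + 1) (by omega) h
    omega
  let R : Fin n → Fin n → Prop := fun i j => i < j ∧ (SimpleGraph.cycleGraph n).Adj (f i) (f j)
  have hRup : ∀ k, c ≤ k → k < n → R (g k) (g (k + 1)) := by
    intro k h1 h2
    refine ⟨hup k h1 h2, ?_⟩
    rw [hfg, hfg]; exact cycleGraph_adj_rot hn v k
  have hRdown : ∀ k < c, R (g (k + 1)) (g k) := by
    intro k h1
    refine ⟨hdown k h1, ?_⟩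
    rw [hfg, hfg]; exact (cycleGraph_adj_rot hn v k).symm
  -- A monotone path can only be prolonged away from `c`, since stepping back lowers the label, and
  -- at positions `0` and `n` the label is already maximal.
  have hext : ∀ k ≤ n, ∀ i, (arcList g c k ++ [i]).IsChain R →
      ∃ k' ≤ n, (k + 1 = k' ∨ k' + 1 = k) ∧ arcList g c k' = arcList g c k ++ [i] := by
    intro k hk i hi
    rw [List.isChain_append, getLast?_arcList] at hi
    obtain ⟨hlt, hadj⟩ : R (g k) i := hi.2.2 _ rfl _ rfl
    have hk0 : k ≠ 0 := by
      rintro rfl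
      rw [hg0] at hlt
      exact absurd hlt (not_lt.2 (hgn i))
    have hkn : k ≠ n := by
      rintro rfl
      exact absurd hlt (not_lt.2 (hgn i))
    rw [hfg] at hadj
    rcases eq_rot_of_adj hn (by omega) hadj with h | h
    · have hi : i = g (k + 1) := (f.symm_apply_eq.2 h.symm).symm
      rcases le_or_gt c k with hck | hck
      · exact ⟨k + 1, by omega, Or.inl rfl, by rw [arcList_succ g c hck, hi]⟩
      · rw [hi] at hlt
        exact absurd hlt (hdown k hck).asymm
    · have hi : i = g (k - 1) := (f.symm_apply_eq.2 h.symm).symm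
      rcases le_or_gt k c with hck | hck
      · refine ⟨k - 1, by omega, Or.inr (by omega), ?_⟩
        rw [arcList_of_lt g c (by omega), hi, Nat.sub_add_cancel (by omega)]
      · rw [hi] at hlt
        have := hup (k - 1) (by omega) (by omega)
        rw [Nat.sub_add_cancel (by omega)] at this
        exact absurd hlt this.asymm
  let F : Fin (n + 1) → MonotonePath (SimpleGraph.cycleGraph n) f := fun k =>
    { labels := arcList g c k.val
      labels_ne_nil := arcList_ne_nil g c k.val
      head_eq_zero := by
        have h := head?_arcList g c k.val
        rw [List.head?_eq_some_head (arcList_ne_nil g c k.val), Option.some_inj] at h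
        rw [h, hgc]
      isChain := isChain_arcList g c hRup hRdown (by omega) }
  have hFl : ∀ k, (F k).labels = arcList g c k.val := fun k => rfl
  have hFinj : Function.Injective F := fun k l h =>
    Fin.ext (arcList_injOn g c hc0 hcn hginj hne (by omega) (by omega)
      (congrArg MonotonePath.labels h))
  have hsurj : ∀ l : List (Fin n), l ≠ [] → (∀ x ∈ l.head?, x.val = 0) → l.IsChain R →
      ∃ k ≤ n, arcList g c k = l := by
    intro l
    induction l using List.reverseRecOn with
    | nil => intro h; exact absurd rfl h
    | append_singleton l i ih =>
      intro _ hhead hchain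
      rcases eq_or_ne l [] with rfl | hl
      · refine ⟨c, hcn.le, ?_⟩
        rw [arcList_self, List.nil_append]
        congr 1
        ext
        rw [hgc, hhead i rfl]
      · obtain ⟨k, hk, rfl⟩ := ih hl (by
          intro x hx
          apply hhead x
          rw [List.head?_append]
          simp only [Option.mem_def] at hx ⊢
          rw [hx]; rfl) (List.isChain_append.1 hchain).1
        obtain ⟨k', hk', -, h⟩ := hext k hk i hchain
        exact ⟨k', hk', h⟩
  have hFsurj : Function.Surjective F := by
    intro p
    obtain ⟨k, hk, h⟩ := hsurj p.labels p.labels_ne_nil (by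
      intro x hx
      rw [List.head?_eq_some_head p.labels_ne_nil, Option.mem_some_iff] at hx
      rw [← hx]; exact p.head_eq_zero) p.isChain
    exact ⟨⟨k, by omega⟩, MonotonePath.ext_labels h⟩
  have hstep : ∀ k l : Fin (n + 1), k.val + 1 = l.val →
      (monotonePathTree (SimpleGraph.cycleGraph n) f).Adj (F k) (F l) := by
    intro k l h
    rcases le_or_gt c k.val with hck | hck
    · exact Or.inl ⟨g (k + 1), by rw [hFl, hFl, ← h, arcList_succ g c hck]⟩
    · exact Or.inr ⟨g k, by rw [hFl, hFl, ← h, ← arcList_of_lt g c hck]⟩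
  have hstep' : ∀ k l : Fin (n + 1), (∃ i, (F l).labels = (F k).labels ++ [i]) →
      k.val + 1 = l.val ∨ l.val + 1 = k.val := by
    rintro k l ⟨i, hi⟩
    obtain ⟨k', hk', h, h'⟩ := hext k.val (by omega) i (by
      have := (F l).isChain
      rw [hi] at this
      exact this)
    have : l = ⟨k', by omega⟩ := hFinj (MonotonePath.ext_labels (hi.trans h'.symm))
    rw [this]
    exact h
  refine ⟨⟨Equiv.ofBijective F ⟨hFinj, hFsurj⟩, ?_⟩, ?_⟩
  · intro k l
    rw [SimpleGraph.pathGraph_adj]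
    change (monotonePathTree (SimpleGraph.cycleGraph n) f).Adj (F k) (F l) ↔ _
    constructor
    · rintro (h | h)
      · exact hstep' k l h
      · exact (hstep' l k h).symm
    · rintro (h | h)
      · exact hstep k l h
      · exact (hstep l k h).symm
  · intro k
    change f ((arcList g c k.val).getLast _) = _
    have h := getLast?_arcList g c k.val
    rw [List.getLast?_eq_some_getLast (arcList_ne_nil g c k.val), Option.some_inj] at h
    rw [h, hfg]


/-! ### Pulling back blow-up graphs -/

namespace WeightedBlowup

variable {V W : Type*} {H : SimpleGraph V} {T : SimpleGraph W}

open Classical in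
theorem density_comm (B : WeightedBlowup H) (u v : V) : B.density u v = B.density v u := by
  unfold density
  rw [Finset.sum_comm]
  refine Finset.sum_congr rfl fun b _ => Finset.sum_congr rfl fun a _ => ?_
  exact if_congr (B.graph.adj_comm _ _) (mul_comm _ _) rfl

/-- The pullback of a weighted blow-up graph along a map of the vertices. -/
def comap (B : WeightedBlowup H) (T : SimpleGraph W) (π : W → V) : WeightedBlowup T where
  Cluster p := B.Cluster (π p)
  graph :=
    { Adj := fun x y => T.Adj x.1 y.1 ∧ B.graph.Adj ⟨π x.1, x.2⟩ ⟨π y.1, y.2⟩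
      symm := ⟨fun _ _ h => ⟨h.1.symm, h.2.symm⟩⟩
      loopless := ⟨fun _ h => h.1.ne rfl⟩ }
  adj_of_adj _ _ h := h.1
  weight x := B.weight ⟨π x.1, x.2⟩
  weight_nonneg _ := B.weight_nonneg _
  sum_weight p := B.sum_weight (π p)

open Classical in
theorem comap_density (B : WeightedBlowup H) (π : W → V) {p q : W} (h : T.Adj p q) :
    (B.comap T π).density p q = B.density (π p) (π q) := by
  unfold density
  refine Finset.sum_congr rfl fun a _ => Finset.sum_congr rfl fun b _ => ?_
  have : (B.comap T π).graph.Adj ⟨p, a⟩ ⟨q, b⟩ ↔ B.graph.Adj ⟨π p, a⟩ ⟨π q, b⟩ :=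
    ⟨fun h => h.2, fun h' => ⟨h, h'⟩⟩
  exact if_congr this rfl rfl

/-- A transversal can be pushed forward along a quotient map which only identifies vertices over
a cluster with at most one element. -/
theorem HasTransversal.of_comap {B : WeightedBlowup H} {π : W → V} {v : V}
    (hv : Subsingleton (B.Cluster v)) (hπ : Function.Surjective π)
    (hadj : ∀ u u', H.Adj u u' → ∃ p q, T.Adj p q ∧ π p = u ∧ π q = u')
    (hinj : ∀ p q, π p = π q → p = q ∨ π p = v)
    (h : (B.comap T π).HasTransversal) : B.HasTransversal := by
  obtain ⟨φ, hφ⟩ := h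
  have hsub : ∀ x y : Σ u, B.Cluster u, x.1 = v → y.1 = v → x = y := by
    rintro ⟨u, a⟩ ⟨u', b⟩ h h'
    simp only at h h'
    subst h
    subst h'
    rw [Subsingleton.elim a b]
  -- The chosen vertex depends only on the image under `π`: fibres are single points except over
  -- `v`, whose cluster leaves no choice.
  have key : ∀ u, ∃ a : B.Cluster u, ∀ p, π p = u → (⟨π p, φ p⟩ : Σ u, B.Cluster u) = ⟨u, a⟩ := by
    intro u
    obtain ⟨q, rfl⟩ := hπ u
    refine ⟨φ q, fun p hp => ?_⟩
    rcases hinj p q hp with rfl | hpv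
    · rfl
    · exact hsub _ _ hpv (hp.symm.trans hpv)
  choose ψ hψ using key
  refine ⟨ψ, fun u u' huu' => ?_⟩
  obtain ⟨p, q, hpq, hp, hq⟩ := hadj u u' huu'
  have := (hφ p q hpq).2
  rwa [hψ u p hp, hψ u' q hq] at this

end WeightedBlowup

/-! ### A blow-up of the path without a transversal -/

section path

variable (n : ℕ)

/-- The edges of the extremal blow-up graph of a path on `n + 1` vertices, directed along the
path. In each cluster, `true` is the vertex reachable from the start. -/
def pathStep (k : ℕ) (a : Bool) (l : ℕ) (b : Bool) : Prop :=
  k + 1 = l ∧ ¬(a = true ∧ b = false) ∧ ¬(k = 0 ∧ a = false) ∧ ¬(l = n ∧ b = true)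

/-- The extremal weighted blow-up graph of a path on `n + 1` vertices. -/
def pathBlowup (s : ℕ → ℝ) (hs : ∀ k, 0 ≤ s k ∧ s k ≤ 1) :
    WeightedBlowup (SimpleGraph.pathGraph (n + 1)) where
  Cluster _ := Bool
  graph :=
    { Adj := fun x y => pathStep n x.1 x.2 y.1 y.2 ∨ pathStep n y.1 y.2 x.1 x.2
      symm := ⟨fun _ _ h => h.symm⟩
      loopless := ⟨fun x h => by
        rcases h with h | h <;> exact absurd h.1 (Nat.succ_ne_self _)⟩ }
  adj_of_adj x y h := SimpleGraph.pathGraph_adj.2 (h.imp And.left And.left)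
  weight x := match x.2 with
    | true => s x.1
    | false => 1 - s x.1
  weight_nonneg := by
    rintro ⟨k, _ | _⟩
    · simpa using (hs k).2
    · exact (hs k).1
  sum_weight k := by
    rw [Fintype.sum_bool]
    ring

variable {n}

/-- The missing pair `true`–`false` costs `s k * (1 - s (k + 1))`. The further edges removed at the
two ends cost nothing, as they meet vertices of weight `0`. -/
theorem pathBlowup_density {s : ℕ → ℝ} (hs : ∀ k, 0 ≤ s k ∧ s k ≤ 1) (h0 : s 0 = 1)
    (hn : s n = 0) {k l : Fin (n + 1)} (hkl : k.val + 1 = l.val) :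
    (pathBlowup n s hs).density k l = 1 - s k * (1 - s (k + 1)) := by
  have hadj : ∀ a b : Bool, (pathBlowup n s hs).graph.Adj ⟨k, a⟩ ⟨l, b⟩ ↔
      (¬(a = true ∧ b = false) ∧ ¬(k.val = 0 ∧ a = false) ∧ ¬(l.val = n ∧ b = true)) := by
    intro a b
    constructor
    · rintro (h | h)
      · exact h.2
      · have h1 : l.val + 1 = k.val := h.1
        omega
    · intro h
      exact Or.inl ⟨hkl, h⟩
  have hw : ∀ k, (pathBlowup n s hs).weight ⟨k, true⟩ = s k := fun _ => rfl
  have hw' : ∀ k, (pathBlowup n s hs).weight ⟨k, false⟩ = 1 - s k := fun _ => rfl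
  rw [hkl]
  unfold WeightedBlowup.density
  change (∑ a : Bool, ∑ b : Bool, _) = _
  rw [Fintype.sum_bool, Fintype.sum_bool, Fintype.sum_bool]
  simp only [hadj, hw, hw']
  by_cases h1 : k.val = 0 <;> by_cases h2 : l.val = n
  · simp [h1, h2, h0, hn]
  · simp [h1, h2, h0]
  · simp [h1, h2, hn]
  · simp [h1, h2]; ring

/-- The start forces `true`, each step preserves `true`, and the far end accepts only `false`. -/
theorem pathBlowup_not_hasTransversal {s : ℕ → ℝ} (hs : ∀ k, 0 ≤ s k ∧ s k ≤ 1) (hn : 0 < n)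
    (φ : Fin (n + 1) → Bool)
    (hφ : ∀ k l : Fin (n + 1), k.val + 1 = l.val →
      (pathBlowup n s hs).graph.Adj ⟨k, φ k⟩ ⟨l, φ l⟩) : False := by
  have hstep : ∀ k (hk : k < n), pathStep n k (φ ⟨k, by omega⟩) (k + 1) (φ ⟨k + 1, by omega⟩) := by
    intro k hk
    rcases hφ ⟨k, by omega⟩ ⟨k + 1, by omega⟩ rfl with h | h
    · exact h
    · have h1 : k + 1 + 1 = k := h.1
      omega
  have htrue : ∀ k (hk : k < n), φ ⟨k, by omega⟩ = true := by
    intro k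
    induction k with
    | zero =>
      intro hk
      have := (hstep 0 hk).2.2.1
      simpa using this
    | succ k ih =>
      intro hk
      have := (hstep k (by omega)).2.1
      simpa [ih (by omega)] using this
  have h := hstep (n - 1) (by omega)
  have h1 := h.2.1
  have h2 := h.2.2.2
  rw [htrue (n - 1) (by omega)] at h1
  simp only [Nat.sub_add_cancel hn, true_and, Bool.not_eq_true] at h1 h2
  exact h1 h2

end path

/-! ### Consequences of cutting the cycle at a vertex -/

section cut

variable {n : ℕ} {γ : Sym2 (Fin n) → ℝ}

/-- If the densities of `C_n`, cut at `v`, ensure the path on `n + 1` vertices, then any blow-up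
graph of `C_n` with a one-vertex cluster at `v` contains a transversal. -/
theorem hasTransversal_of_subsingleton (hn : 3 ≤ n)
    (hens : ∀ f : Fin n ≃ Fin n, IsProperLabeling (SimpleGraph.cycleGraph n) f →
      Ensures (monotonePathTree (SimpleGraph.cycleGraph n) f)
        (monotonePathTreeWeight (SimpleGraph.cycleGraph n) f γ))
    (B : WeightedBlowup (SimpleGraph.cycleGraph n))
    (hB : ∀ u v, (SimpleGraph.cycleGraph n).Adj u v → γ s(u, v) ≤ B.density u v)
    {v : Fin n} (hv : Subsingleton (B.Cluster v)) : B.HasTransversal := by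
  obtain ⟨f, hf, hfv⟩ := exists_isProperLabeling hn v
  obtain ⟨e, he⟩ := hf.exists_iso hn hfv
  have hedge : ∀ u, ∃ p q, (monotonePathTree (SimpleGraph.cycleGraph n) f).Adj p q ∧
      p.lastVertex = u ∧ q.lastVertex = rot u 1 := by
    intro u
    obtain ⟨k, hk, rfl⟩ := exists_rot v u
    refine ⟨e ⟨k, by omega⟩, e ⟨k + 1, by omega⟩, ?_, he _, ?_⟩
    · rw [e.map_adj_iff, SimpleGraph.pathGraph_adj]; exact Or.inl rfl
    · rw [he, rot_rot]
  refine WeightedBlowup.HasTransversal.of_comap (π := MonotonePath.lastVertex)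
    (T := monotonePathTree (SimpleGraph.cycleGraph n) f) hv ?_ ?_ ?_ (hens f hf _ ?_)
  · intro u
    obtain ⟨p, -, -, hp, -⟩ := hedge u
    exact ⟨p, hp⟩
  · intro u u' h
    rcases (cycleGraph_adj_iff hn _ _).1 h with rfl | rfl
    · exact hedge u
    · obtain ⟨p, q, hpq, hp, hq⟩ := hedge u'
      exact ⟨q, p, hpq.symm, hq, hp⟩
  · intro p q hpq
    obtain ⟨k, rfl⟩ := e.surjective p
    obtain ⟨l, rfl⟩ := e.surjective q
    rw [he, he] at hpq
    -- Two positions among `0, …, n` over the same vertex are equal, unless one of them is `n`,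
    -- which lies over `v`.
    rw [he]
    by_cases hk : k.val = n
    · right; rw [hk, rot_self]
    by_cases hl : l.val = n
    · right; rw [hpq, hl, rot_self]
    · left; rw [Fin.ext (rot_inj (by omega) (by omega) hpq)]
  · intro p q hpq
    rw [WeightedBlowup.comap_density _ _ hpq]
    change γ s(p.lastVertex, q.lastVertex) ≤ _
    refine hB _ _ ?_
    obtain ⟨k, rfl⟩ := e.surjective p
    obtain ⟨l, rfl⟩ := e.surjective q
    rw [e.map_adj_iff, SimpleGraph.pathGraph_adj] at hpq
    rw [he, he]
    rcases hpq with h | h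
    · rw [← h]; exact cycleGraph_adj_rot hn v _
    · rw [← h]; exact (cycleGraph_adj_rot hn v _).symm

/-- If the densities of `C_n`, cut at `v`, ensure the path on `n + 1` vertices, then there is no
sequence of weights for the extremal blow-up graph of the path. -/
theorem false_of_certificate (hn : 3 ≤ n)
    (hens : ∀ f : Fin n ≃ Fin n, IsProperLabeling (SimpleGraph.cycleGraph n) f →
      Ensures (monotonePathTree (SimpleGraph.cycleGraph n) f)
        (monotonePathTreeWeight (SimpleGraph.cycleGraph n) f γ))
    (v : Fin n) {s : ℕ → ℝ} (hs : ∀ k, 0 ≤ s k ∧ s k ≤ 1) (h0 : s 0 = 1) (hsn : s n = 0)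
    (h : ∀ k < n, γ s(rot v k, rot v (k + 1)) ≤ 1 - s k * (1 - s (k + 1))) : False := by
  obtain ⟨f, hf, hfv⟩ := exists_isProperLabeling hn v
  obtain ⟨e, he⟩ := hf.exists_iso hn hfv
  obtain ⟨φ, hφ⟩ := hens f hf ((pathBlowup n s hs).comap _ e.symm) (by
    intro p q hpq
    rw [WeightedBlowup.comap_density _ _ hpq]
    obtain ⟨k, rfl⟩ := e.surjective p
    obtain ⟨l, rfl⟩ := e.surjective q
    rw [e.symm_apply_apply, e.symm_apply_apply]
    change γ s((e k).lastVertex, (e l).lastVertex) ≤ _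
    rw [e.map_adj_iff, SimpleGraph.pathGraph_adj] at hpq
    rw [he, he]
    rcases hpq with hkl | hkl
    · rw [pathBlowup_density hs h0 hsn hkl, ← hkl]
      exact h _ (by omega)
    · rw [WeightedBlowup.density_comm, pathBlowup_density hs h0 hsn hkl, ← hkl, Sym2.eq_swap]
      exact h _ (by omega))
  refine pathBlowup_not_hasTransversal hs (by omega) (fun k => φ (e k)) fun k l hkl => ?_
  have hadj := (hφ (e k) (e l) (by
    rw [e.map_adj_iff, SimpleGraph.pathGraph_adj]; exact Or.inl hkl)).2
  rcases hadj with hadj | hadj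
  · left
    change pathStep n (e.symm (e k)).val (φ (e k)) (e.symm (e l)).val (φ (e l)) at hadj
    rwa [e.symm_apply_apply, e.symm_apply_apply] at hadj
  · right
    change pathStep n (e.symm (e l)).val (φ (e l)) (e.symm (e k)).val (φ (e k)) at hadj
    rwa [e.symm_apply_apply, e.symm_apply_apply] at hadj

end cut

/-! ### Minimal counterexamples have small clusters -/

namespace WeightedBlowup

variable {V : Type*} {H : SimpleGraph V}

open Classical in
/-- The total weight of the neighbours of `x` in the cluster of `u`. -/
noncomputable def deg (B : WeightedBlowup H) (u : V) (x : Σ v, B.Cluster v) : ℝ :=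
  ∑ b : B.Cluster u, if B.graph.Adj x ⟨u, b⟩ then B.weight ⟨u, b⟩ else 0

theorem density_eq_sum_deg (B : WeightedBlowup H) (u v : V) :
    B.density u v = ∑ a : B.Cluster u, B.weight ⟨u, a⟩ * B.deg v ⟨u, a⟩ := by
  unfold density deg
  refine Finset.sum_congr rfl fun a _ => ?_
  rw [Finset.mul_sum]
  refine Finset.sum_congr rfl fun b _ => ?_
  rw [mul_ite, mul_zero]

/-- The same blow-up graph with other weights. -/
def reweight (B : WeightedBlowup H) (w : (Σ v, B.Cluster v) → ℝ) (hw : ∀ x, 0 ≤ w x)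
    (hsum : ∀ v, ∑ a : B.Cluster v, w ⟨v, a⟩ = 1) : WeightedBlowup H where
  Cluster := B.Cluster
  graph := B.graph
  adj_of_adj := B.adj_of_adj
  weight := w
  weight_nonneg := hw
  sum_weight := hsum

open Classical in
theorem sum_ne_eq (B : WeightedBlowup H) (x : Σ v, B.Cluster v) (v : V) (g : B.Cluster v → ℝ)
    (hg : ∀ a, (⟨v, a⟩ : Σ v, B.Cluster v) = x → g a = 0) :
    ∑ a : {a : B.Cluster v // (⟨v, a⟩ : Σ v, B.Cluster v) ≠ x}, g a.1 = ∑ a, g a := by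
  rw [← Finset.sum_subtype (Finset.univ.filter
    fun a : B.Cluster v => (⟨v, a⟩ : Σ v, B.Cluster v) ≠ x) (by simp) g]
  refine Finset.sum_filter_of_ne fun a _ h h' => h (hg a h')

open Classical in
/-- Deletion of a vertex of weight zero. -/
noncomputable def erase (B : WeightedBlowup H) (x : Σ v, B.Cluster v) (hx : B.weight x = 0) :
    WeightedBlowup H where
  Cluster v := {a : B.Cluster v // (⟨v, a⟩ : Σ v, B.Cluster v) ≠ x}
  graph := B.graph.comap fun y => ⟨y.1, y.2.1⟩
  adj_of_adj _ _ h := B.adj_of_adj _ _ h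
  weight y := B.weight ⟨y.1, y.2.1⟩
  weight_nonneg _ := B.weight_nonneg _
  sum_weight v := by
    rw [B.sum_ne_eq x v (fun a => B.weight ⟨v, a⟩) (fun a h => h ▸ hx)]
    exact B.sum_weight v

open Classical in
theorem erase_density (B : WeightedBlowup H) (x : Σ v, B.Cluster v) (hx : B.weight x = 0)
    (u v : V) : (B.erase x hx).density u v = B.density u v := by
  unfold density
  change (∑ a : {a : B.Cluster u // (⟨u, a⟩ : Σ v, B.Cluster v) ≠ x},
    ∑ b : {b : B.Cluster v // (⟨v, b⟩ : Σ v, B.Cluster v) ≠ x},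
    if B.graph.Adj ⟨u, a.1⟩ ⟨v, b.1⟩ then B.weight ⟨u, a.1⟩ * B.weight ⟨v, b.1⟩ else 0) = _
  have h1 : ∀ a : B.Cluster u, (∑ b : {b : B.Cluster v // (⟨v, b⟩ : Σ v, B.Cluster v) ≠ x},
      if B.graph.Adj ⟨u, a⟩ ⟨v, b.1⟩ then B.weight ⟨u, a⟩ * B.weight ⟨v, b.1⟩ else 0) =
      ∑ b : B.Cluster v,
        if B.graph.Adj ⟨u, a⟩ ⟨v, b⟩ then B.weight ⟨u, a⟩ * B.weight ⟨v, b⟩ else 0 :=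
    fun a => B.sum_ne_eq x v
      (fun b => if B.graph.Adj ⟨u, a⟩ ⟨v, b⟩ then B.weight ⟨u, a⟩ * B.weight ⟨v, b⟩ else 0)
      (fun b h => by simp [h, hx])
  simp only [h1]
  exact B.sum_ne_eq x u (fun a => ∑ b : B.Cluster v,
    if B.graph.Adj ⟨u, a⟩ ⟨v, b⟩ then B.weight ⟨u, a⟩ * B.weight ⟨v, b⟩ else 0)
    (fun a h => Finset.sum_eq_zero fun b _ => by simp [h, hx])

theorem HasTransversal.of_erase {B : WeightedBlowup H} {x : Σ v, B.Cluster v}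
    {hx : B.weight x = 0} (h : (B.erase x hx).HasTransversal) : B.HasTransversal := by
  obtain ⟨φ, hφ⟩ := h
  exact ⟨fun v => (φ v).1, hφ⟩

/-- The total number of vertices. -/
noncomputable def size (B : WeightedBlowup H) : ℕ := Nat.card (Σ v, B.Cluster v)

theorem size_erase_lt [Finite V] (B : WeightedBlowup H) (x : Σ v, B.Cluster v)
    (hx : B.weight x = 0) : (B.erase x hx).size < B.size := by
  let F : (Σ v, (B.erase x hx).Cluster v) → (Σ v, B.Cluster v) := fun y => ⟨y.1, y.2.1⟩
  have hF : Function.Injective F := by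
    rintro ⟨u, a, ha⟩ ⟨v, b, hb⟩ h
    obtain rfl : u = v := congrArg Sigma.fst h
    obtain rfl : a = b := eq_of_heq (Sigma.mk.inj h).2
    rfl
  refine Nat.lt_of_le_of_ne (Nat.card_le_card_of_injective F hF) fun h => ?_
  have hb := (Nat.bijective_iff_injective_and_card F).2 ⟨hF, h⟩
  obtain ⟨⟨u, a, ha⟩, h⟩ := hb.2 x
  exact ha h

variable {γ : Sym2 V → ℝ}

/-- A blow-up graph showing that the densities `γ` do not ensure `H`, with the least number of
vertices. -/
structure IsMinimalCounterexample (B : WeightedBlowup H) (γ : Sym2 V → ℝ) : Prop where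
  le_density : ∀ u v, H.Adj u v → γ s(u, v) ≤ B.density u v
  not_hasTransversal : ¬ B.HasTransversal
  minimal : ∀ B' : WeightedBlowup H, (∀ u v, H.Adj u v → γ s(u, v) ≤ B'.density u v) →
    ¬ B'.HasTransversal → B.size ≤ B'.size

theorem exists_isMinimalCounterexample (h : ¬ Ensures H γ) :
    ∃ B : WeightedBlowup H, B.IsMinimalCounterexample γ := by
  unfold Ensures at h
  push Not at h
  obtain ⟨B₀, h₀⟩ := h
  obtain ⟨B, hB, hmin⟩ := (measure (size (H := H))).wf.has_min
    {B | (∀ u v, H.Adj u v → γ s(u, v) ≤ B.density u v) ∧ ¬ B.HasTransversal} ⟨B₀, h₀⟩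
  exact ⟨B, hB.1, hB.2, fun B' h1 h2 => not_lt.1 (hmin B' ⟨h1, h2⟩)⟩

namespace IsMinimalCounterexample

variable [Finite V] {B : WeightedBlowup H}

/-- Transversals ignore weights, so reweighting without losing density gives another counterexample;
a vertex of weight zero in it could be deleted, against minimality. -/
theorem reweight_ne_zero (hB : B.IsMinimalCounterexample γ) {w : (Σ v, B.Cluster v) → ℝ}
    (hw : ∀ x, 0 ≤ w x) (hsum : ∀ v, ∑ a : B.Cluster v, w ⟨v, a⟩ = 1)
    (hd : ∀ u v, H.Adj u v → B.density u v ≤ (B.reweight w hw hsum).density u v)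
    (x : Σ v, B.Cluster v) : w x ≠ 0 := by
  intro hx
  refine absurd (hB.minimal ((B.reweight w hw hsum).erase x hx) ?_ ?_)
    (not_le.2 ((B.reweight w hw hsum).size_erase_lt x hx))
  · intro u v huv
    exact ((hB.le_density u v huv).trans (hd u v huv)).trans (erase_density _ _ _ _ _).ge
  · intro h
    exact hB.not_hasTransversal h.of_erase

theorem weight_pos (hB : B.IsMinimalCounterexample γ) (x : Σ v, B.Cluster v) :
    0 < B.weight x :=
  lt_of_le_of_ne (B.weight_nonneg x)
    (hB.reweight_ne_zero B.weight_nonneg B.sum_weight (fun _ _ _ => le_rfl) x).symm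

/-- In a minimal counterexample the weights in a cluster cannot be shifted without decreasing the
density towards some adjacent cluster. -/
theorem eq_zero_of_shift (hB : B.IsMinimalCounterexample γ) (v : V) (δ : B.Cluster v → ℝ)
    (hsum : ∑ a, δ a = 0) (hδ : ∀ u, H.Adj v u → 0 ≤ ∑ a, δ a * B.deg u ⟨v, a⟩) : δ = 0 := by
  classical
  by_contra hne
  obtain ⟨a₁, ha₁⟩ : ∃ a, δ a < 0 := by
    by_contra! h
    exact hne (funext fun a =>
      (Finset.sum_eq_zero_iff_of_nonneg fun a _ => h a).1 hsum a (Finset.mem_univ a))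
  obtain ⟨a₀, ha₀, hmin⟩ := Finset.exists_min_image (Finset.univ.filter fun a => δ a < 0)
    (fun a => B.weight ⟨v, a⟩ / (-δ a)) ⟨a₁, by simpa using ha₁⟩
  replace ha₀ : δ a₀ < 0 := by simpa using ha₀
  -- The first time at which a weight reaches zero when moving in direction `δ`. Densities at `v`
  -- are affine in the time, the others are unchanged.
  set t := B.weight ⟨v, a₀⟩ / (-δ a₀) with ht
  have ht0 : 0 ≤ t := div_nonneg (B.weight_nonneg _) (by linarith)
  let D : (Σ v, B.Cluster v) → ℝ := fun x => if h : x.1 = v then δ (h ▸ x.2) else 0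
  have hDv : ∀ a, D ⟨v, a⟩ = δ a := fun a => by simp [D]
  have hDu : ∀ u, u ≠ v → ∀ a, D ⟨u, a⟩ = 0 := fun u hu a => by simp [D, hu]
  let w : (Σ v, B.Cluster v) → ℝ := fun x => B.weight x + t * D x
  have hwv : ∀ a, w ⟨v, a⟩ = B.weight ⟨v, a⟩ + t * δ a := fun a => by simp only [w, hDv]
  have hwu : ∀ u, u ≠ v → ∀ a, w ⟨u, a⟩ = B.weight ⟨u, a⟩ := fun u hu a => by
    simp only [w, hDu u hu, mul_zero, add_zero]
  have hw : ∀ x, 0 ≤ w x := by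
    rintro ⟨u, a⟩
    by_cases hu : u = v
    · subst hu
      rw [hwv]
      rcases lt_or_ge (δ a) 0 with h | h
      · have h1 := hmin a (by simpa using h)
        have h2 : t * (-δ a) ≤ B.weight ⟨u, a⟩ := (le_div_iff₀ (by linarith)).1 h1
        linarith
      · exact add_nonneg (B.weight_nonneg _) (mul_nonneg ht0 h)
    · rw [hwu u hu]; exact B.weight_nonneg _
  have hws : ∀ u, ∑ a : B.Cluster u, w ⟨u, a⟩ = 1 := by
    intro u
    by_cases hu : u = v
    · subst hu
      simp only [hwv]
      rw [Finset.sum_add_distrib, ← Finset.mul_sum, hsum, B.sum_weight]; ring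
    · simp only [hwu u hu]; exact B.sum_weight u
  have hdeg : ∀ u, u ≠ v → ∀ x, (B.reweight w hw hws).deg u x = B.deg u x := by
    intro u hu x
    unfold deg
    refine Finset.sum_congr rfl fun b _ => ?_
    exact if_congr Iff.rfl (hwu u hu b) rfl
  have hdv : ∀ u, H.Adj v u → B.density v u ≤ (B.reweight w hw hws).density v u := by
    intro u hu
    rw [density_eq_sum_deg, density_eq_sum_deg]
    have : ∑ a : B.Cluster v, w ⟨v, a⟩ * (B.reweight w hw hws).deg u ⟨v, a⟩ =
        ∑ a, B.weight ⟨v, a⟩ * B.deg u ⟨v, a⟩ + t * ∑ a, δ a * B.deg u ⟨v, a⟩ := by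
      rw [Finset.mul_sum, ← Finset.sum_add_distrib]
      refine Finset.sum_congr rfl fun a _ => ?_
      rw [hdeg u hu.ne', hwv, ← mul_assoc]
      exact add_mul _ _ _
    exact (le_add_of_nonneg_right (mul_nonneg ht0 (hδ u hu))).trans this.ge
  refine hB.reweight_ne_zero hw hws ?_ ⟨v, a₀⟩ ?_
  · intro u u' huu'
    by_cases hu : u = v
    · subst hu; exact hdv u' huu'
    by_cases hu' : u' = v
    · subst hu'
      rw [density_comm, density_comm _ u]
      exact hdv u huu'.symm
    rw [density_eq_sum_deg, density_eq_sum_deg]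
    refine le_of_eq (Finset.sum_congr rfl fun a _ => ?_)
    rw [hdeg u' hu']
    exact congrArg (· * _) (hwu u hu a).symm
  · rw [hwv, ht, div_neg, neg_mul, div_mul_cancel₀ _ ha₀.ne, add_neg_cancel]

/-- In a minimal counterexample, the vertices of a cluster are incomparable. -/
theorem not_dominated (hB : B.IsMinimalCounterexample γ) {v : V} {a b : B.Cluster v}
    (hab : a ≠ b) : ¬ ∀ u, H.Adj v u → B.deg u ⟨v, a⟩ ≤ B.deg u ⟨v, b⟩ := by
  classical
  intro h
  have := hB.eq_zero_of_shift v (Pi.single b 1 - Pi.single a 1)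
    (by simp [Finset.sum_sub_distrib]) (by
      intro u hu
      simp only [Pi.sub_apply, sub_mul, Finset.sum_sub_distrib, Pi.single_apply, ite_mul, one_mul,
        zero_mul, Finset.sum_ite_eq', Finset.mem_univ, if_true]
      exact sub_nonneg.2 (h u hu))
  have h1 := congrFun this a
  simp [hab] at h1

/-- In a minimal counterexample, the cluster of a vertex with exactly two neighbours has at most
two vertices. -/
theorem eq_or_eq_or_eq (hB : B.IsMinimalCounterexample γ) {v u₁ u₂ : V}
    (hv : ∀ u, H.Adj v u → u = u₁ ∨ u = u₂) (a b c : B.Cluster v) : a = b ∨ a = c ∨ b = c := by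
  classical
  by_contra! h
  obtain ⟨hab, hac, hbc⟩ := h
  let d₁ : B.Cluster v → ℝ := fun a => B.deg u₁ ⟨v, a⟩
  let d₂ : B.Cluster v → ℝ := fun a => B.deg u₂ ⟨v, a⟩
  have hne : d₁ a ≠ d₁ b := by
    intro h
    rcases le_total (d₂ a) (d₂ b) with h2 | h2
    · exact hB.not_dominated hab fun u hu => by
        rcases hv u hu with rfl | rfl
        · exact h.le
        · exact h2
    · exact hB.not_dominated hab.symm fun u hu => by
        rcases hv u hu with rfl | rfl
        · exact h.ge
        · exact h2
  -- The cross product of `(1, 1, 1)` with the degrees towards `u₁`, scaled by `t`. It preserves the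
  -- total weight and the density towards `u₁`; the sign of `t` is then chosen so that the density
  -- towards `u₂` does not drop.
  let δ : ℝ → B.Cluster v → ℝ := fun t => Pi.single a (t * (d₁ b - d₁ c)) +
    Pi.single b (t * (d₁ c - d₁ a)) + Pi.single c (t * (d₁ a - d₁ b))
  have hδ : ∀ t (g : B.Cluster v → ℝ), ∑ x, δ t x * g x =
      t * ((d₁ b - d₁ c) * g a + (d₁ c - d₁ a) * g b + (d₁ a - d₁ b) * g c) := by
    intro t g
    simp only [δ, Pi.add_apply, add_mul, Finset.sum_add_distrib, Pi.single_apply, ite_mul,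
      zero_mul, Finset.sum_ite_eq', Finset.mem_univ, if_true]
    ring
  have key : ∀ t, t ≠ 0 →
      0 ≤ t * ((d₁ b - d₁ c) * d₂ a + (d₁ c - d₁ a) * d₂ b + (d₁ a - d₁ b) * d₂ c) → False := by
    intro t ht h
    have h0 := hB.eq_zero_of_shift v (δ t)
      (by
        have := hδ t fun _ => 1
        simp only [mul_one] at this
        rw [this]; ring)
      (by
        intro u hu
        rcases hv u hu with rfl | rfl
        · rw [hδ t fun a => B.deg u ⟨v, a⟩]
          apply le_of_eq
          simp only [d₁]
          ring
        · rw [hδ t fun a => B.deg u ⟨v, a⟩]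
          exact h)
    have h1 := congrFun h0 c
    simp only [δ, Pi.add_apply, Pi.single_eq_same, Pi.single_eq_of_ne hac.symm,
      Pi.single_eq_of_ne hbc.symm, zero_add, Pi.zero_apply, mul_eq_zero] at h1
    rcases h1 with h1 | h1
    · exact ht h1
    · exact hne (sub_eq_zero.1 h1)
  rcases le_total 0 ((d₁ b - d₁ c) * d₂ a + (d₁ c - d₁ a) * d₂ b + (d₁ a - d₁ b) * d₂ c) with h | h
  · exact key 1 one_ne_zero (by linarith)
  · exact key (-1) (by norm_num) (by linarith)

/-- In a minimal counterexample, the cluster of a vertex with exactly two neighbours has at most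
one vertex, or two vertices, each of which has larger degree than the other towards one of the
neighbours. -/
theorem subsingleton_or_pair (hB : B.IsMinimalCounterexample γ) {v u₁ u₂ : V}
    (hv : ∀ u, H.Adj v u → u = u₁ ∨ u = u₂) :
    Subsingleton (B.Cluster v) ∨ ∃ l r : B.Cluster v, l ≠ r ∧ (∀ a, a = l ∨ a = r) ∧
      B.deg u₁ ⟨v, l⟩ < B.deg u₁ ⟨v, r⟩ ∧ B.deg u₂ ⟨v, r⟩ < B.deg u₂ ⟨v, l⟩ := by
  rcases subsingleton_or_nontrivial (B.Cluster v) with h | ⟨a, b, hab⟩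
  · exact Or.inl h
  right
  have hall : ∀ x, x = a ∨ x = b := fun x => by
    rcases hB.eq_or_eq_or_eq hv x a b with h | h | h
    · exact Or.inl h
    · exact Or.inr h
    · exact absurd h hab
  have h1 : ∀ {x y : B.Cluster v}, x ≠ y → B.deg u₁ ⟨v, x⟩ ≤ B.deg u₁ ⟨v, y⟩ →
      B.deg u₂ ⟨v, y⟩ < B.deg u₂ ⟨v, x⟩ := by
    intro x y hxy h
    by_contra! h'
    exact hB.not_dominated hxy fun u hu => by
      rcases hv u hu with rfl | rfl
      · exact h
      · exact h'
  have h2 : ∀ {x y : B.Cluster v}, x ≠ y → B.deg u₂ ⟨v, y⟩ ≤ B.deg u₂ ⟨v, x⟩ →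
      B.deg u₁ ⟨v, x⟩ < B.deg u₁ ⟨v, y⟩ := by
    intro x y hxy h
    by_contra! h'
    exact absurd (h1 hxy.symm h') (not_lt.2 h)
  rcases le_total (B.deg u₁ ⟨v, a⟩) (B.deg u₁ ⟨v, b⟩) with h | h
  · have := h1 hab h
    exact ⟨a, b, hab, hall, h2 hab this.le, this⟩
  · have := h1 hab.symm h
    exact ⟨b, a, hab.symm, fun x => (hall x).symm, h2 hab.symm this.le, this⟩

end IsMinimalCounterexample
end WeightedBlowup

/-! ### Weight sequences for the cut path, and the adjacency patterns -/

section numeric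

/-- Dropping the `1` in each factor `1 + u k` leaves a pure product. -/
theorem mul_prod_le_of_recurrence {u σ : ℕ → ℝ} (hσ : ∀ k, 0 ≤ σ k)
    (hu : ∀ k, u (k + 1) = (1 + u k) * σ k) (m : ℕ) :
    u 0 * ∏ k ∈ Finset.range m, σ k ≤ u m := by
  induction m with
  | zero => simp
  | succ m ih =>
    rw [Finset.prod_range_succ, ← mul_assoc, hu]
    exact mul_le_mul_of_nonneg_right (ih.trans (by linarith)) (hσ m)

/-- A certificate for the cycle whose edges have complementary densities `(1 - P k) * P (k + 1)`
for `0 < k < n` and `1 - P n * (1 - P 1)`. -/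
theorem exists_certificate {n : ℕ} (hn : 3 ≤ n) {P : ℕ → ℝ} (hP : ∀ k, 0 < P k ∧ P k < 1)
    (hprod : 1 ≤ ∏ k ∈ Finset.range (n - 2), (1 - P (k + 2)) / P (k + 2)) :
    ∃ s : ℕ → ℝ, (∀ k, 0 ≤ s k ∧ s k ≤ 1) ∧ s 0 = 1 ∧ s n = 0 ∧
      (∀ k, k + 1 < n → s k * (1 - s (k + 1)) ≤ (1 - P (k + 1)) * P (k + 2)) ∧
      s (n - 1) ≤ 1 - P n * (1 - P 1) := by
  -- Demanding equality along the path from `s 0 = 1` gives a fractional linear recursion for `s`;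
  -- the substitution `s k = (1 - P (k + 1)) * (1 + u k) / u k` makes it affine in `u`.
  let u : ℕ → ℝ := fun k => Nat.rec ((1 - P 1) / P 1)
    (fun k x => (1 + x) * ((1 - P (k + 2)) / P (k + 2))) k
  have hu0 : u 0 = (1 - P 1) / P 1 := rfl
  have hu : ∀ k, u (k + 1) = (1 + u k) * ((1 - P (k + 2)) / P (k + 2)) := fun _ => rfl
  have hσ : ∀ k, 0 < (1 - P k) / P k := fun k => div_pos (by linarith [hP k]) (hP k).1
  have hupos : ∀ k, 0 < u k := by
    intro k
    induction k with
    | zero => exact hσ 1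
    | succ k ih => rw [hu]; exact mul_pos (by linarith) (hσ _)
  let s : ℕ → ℝ := fun k => if k < n then (1 - P (k + 1)) * ((1 + u k) / u k) else 0
  have hs : ∀ k, k < n → s k = (1 - P (k + 1)) * ((1 + u k) / u k) := fun k hk => if_pos hk
  have hs0 : s 0 = 1 := by
    rw [hs 0 (by omega), hu0]
    have := (hP 1).1.ne'
    have : 1 - P 1 ≠ 0 := by linarith [hP 1]
    field_simp
    ring
  have hs1 : ∀ k, k + 1 < n → s (k + 1) = 1 - P (k + 2) * (u k / (1 + u k)) := by
    intro k hk
    rw [hs _ hk, hu]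
    have h1 := (hP (k + 2)).1.ne'
    have h2 : 1 - P (k + 2) ≠ 0 := by linarith [hP (k + 2)]
    have h3 : 1 + u k ≠ 0 := by linarith [hupos k]
    rw [show k + 1 + 1 = k + 2 from rfl]
    field_simp
    ring
  refine ⟨s, ?_, hs0, if_neg (lt_irrefl n), ?_, ?_⟩
  · intro k
    by_cases hk : k < n
    · constructor
      · rw [hs k hk]
        exact mul_nonneg (by linarith [hP (k + 1)])
          (div_nonneg (by linarith [hupos k]) (hupos k).le)
      · rcases Nat.eq_zero_or_pos k with rfl | h
        · exact hs0.le
        · obtain ⟨k, rfl⟩ : ∃ m, k = m + 1 := ⟨k - 1, by omega⟩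
          rw [hs1 k hk]
          have := mul_nonneg (hP (k + 2)).1.le
            (div_nonneg (hupos k).le (by linarith [hupos k] : 0 ≤ 1 + u k))
          linarith
    · simp [s, hk]
  · intro k hk
    rw [hs1 k hk, hs k (by omega)]
    apply le_of_eq
    have h1 := (hupos k).ne'
    have h2 : 1 + u k ≠ 0 := by linarith [hupos k]
    field_simp
    ring
  · have h := hs1 (n - 2) (by omega)
    rw [show n - 2 + 1 = n - 1 by omega, show n - 2 + 2 = n by omega] at h
    rw [h]
    have h1 : u 0 ≤ u (n - 2) :=
      (le_mul_of_one_le_right (hupos 0).le hprod).trans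
        (mul_prod_le_of_recurrence (fun k => (hσ (k + 2)).le) hu (n - 2))
    rw [hu0, div_le_iff₀ (hP 1).1] at h1
    -- Here `1 - P 1 = u 0 / (1 + u 0)`, so the closing inequality amounts to `u 0 ≤ u (n - 2)`.
    have h2 : 1 - P 1 ≤ u (n - 2) / (1 + u (n - 2)) := by
      rw [le_div_iff₀ (by linarith [hupos (n - 2)])]
      linarith
    linarith [mul_le_mul_of_nonneg_left h2 (hP n).1.le]

/-- The mirror image of `exists_certificate`. -/
theorem exists_certificate_reverse {n : ℕ} (hn : 3 ≤ n) {P : ℕ → ℝ}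
    (hP : ∀ k, 0 < P k ∧ P k < 1)
    (hprod : 1 ≤ ∏ k ∈ Finset.range (n - 2), P (k + 2) / (1 - P (k + 2))) :
    ∃ s : ℕ → ℝ, (∀ k, 0 ≤ s k ∧ s k ≤ 1) ∧ s 0 = 1 ∧ s n = 0 ∧
      (∀ k, 0 < k → k < n → s k * (1 - s (k + 1)) ≤ (1 - P k) * P (k + 1)) ∧
      1 - s 1 ≤ 1 - P n * (1 - P 1) := by
  -- Reversing the direction of the cycle exchanges `L` and `R`, hence `P k` becomes `1 - P (n + 1 -
  -- k)` and `s k` becomes `1 - s (n - k)`.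
  obtain ⟨s, hs, hs0, hsn, h1, h2⟩ := exists_certificate hn (P := fun k => 1 - P (n + 1 - k))
    (fun k => ⟨by linarith [hP (n + 1 - k)], by linarith [hP (n + 1 - k)]⟩) (by
      refine hprod.trans (le_of_eq ?_)
      rw [← Finset.prod_range_reflect]
      refine Finset.prod_congr rfl fun k hk => ?_
      rw [Finset.mem_range] at hk
      rw [show n - 2 - 1 - k + 2 = n + 1 - (k + 2) by omega, sub_sub_cancel])
  refine ⟨fun k => 1 - s (n - k), fun k => ⟨by linarith [hs (n - k)], by linarith [hs (n - k)]⟩,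
    by simp [hsn], by simp [hs0], fun k hk hkn => ?_, ?_⟩
  · have := h1 (n - (k + 1)) (by omega)
    rw [show n - (k + 1) + 1 = n - k by omega, show n + 1 - (n - k) = k + 1 by omega,
      show n + 1 - (n - (k + 1) + 2) = k by omega] at this
    linarith
  · simp only [Nat.add_sub_cancel, show n + 1 - n = 1 by omega] at h2
    linarith

open Classical in
/-- The possible adjacencies between two clusters `{L, R}` and `{L', R'}` of weights `q, p` and
`q', p'`, if `R` has larger degree than `L` and `L'` has larger degree than `R'`. -/
theorem adjacency_cases (LL LR RL RR : Prop) {p q p' q' : ℝ} (hp : 0 < p) (hq : 0 < q)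
    (hp' : 0 < p') (hq' : 0 < q') (hqp : q + p = 1) (hqp' : q' + p' = 1)
    (hrow : (if LL then q' else 0) + (if LR then p' else 0) <
      (if RL then q' else 0) + (if RR then p' else 0))
    (hcol : (if LR then q else 0) + (if RR then p else 0) <
      (if LL then q else 0) + (if RL then p else 0)) {d : ℝ}
    (hd : d = q * ((if LL then q' else 0) + (if LR then p' else 0)) +
      p * ((if RL then q' else 0) + (if RR then p' else 0))) :
    (LL ∧ RR ∧ d ≤ 1 - q * p' ∧ (RL ∨ (p < q ∧ q' < p'))) ∨
      (d ≤ 1 - p' ∧ d ≤ 1 - q ∧ (LR ∨ d ≤ p * q')) := by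
  obtain rfl : q = 1 - p := by linarith
  obtain rfl : q' = 1 - p' := by linarith
  have h1 := mul_pos hp hp'
  have h2 := mul_pos hp hq'
  have h3 := mul_pos hq hp'
  have h4 := mul_pos hq hq'
  -- Of the sixteen patterns only four satisfy both strict inequalities: `LL, RR` with or without
  -- `RL`, and `RL` with or without `LR`.
  by_cases hLL : LL <;> by_cases hLR : LR <;> by_cases hRL : RL <;> by_cases hRR : RR <;>
    simp only [hLL, hLR, hRL, hRR, if_true, if_false] at hrow hcol hd <;>
    first
      | (exfalso; linarith)
      | (left; refine ⟨hLL, hRR, by nlinarith, ?_⟩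
         first
          | exact Or.inl hRL
          | exact Or.inr ⟨by linarith, by linarith⟩)
      | (right; refine ⟨by nlinarith, by nlinarith, ?_⟩
         first
          | exact Or.inl hLR
          | exact Or.inr (by linarith))

end numeric

/-! ### The theorem for cycles -/

open Classical in
theorem generalStarDecomposition_cycleGraph {n : ℕ} (hn : 3 ≤ n) :
    GeneralStarDecomposition (SimpleGraph.cycleGraph n) := by
  intro γ _ hens
  by_contra hcon
  obtain ⟨B, hB⟩ := WeightedBlowup.exists_isMinimalCounterexample hcon
  have hprv : ∀ v : Fin n, rot (rot v 1) (n - 1) = v := fun v => by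
    rw [rot_rot, Nat.add_sub_cancel' (by omega), rot_self]
  have hnb : ∀ v u : Fin n, (SimpleGraph.cycleGraph n).Adj v u →
      u = rot v 1 ∨ u = rot v (n - 1) := by
    intro v u h
    rcases (cycleGraph_adj_iff hn _ _).1 h with rfl | rfl
    · exact Or.inl rfl
    · exact Or.inr (hprv u).symm
  have hsucc : ∀ (v : Fin n) k, rot (rot v k) 1 = rot v (k + 1) := fun v k => rot_rot v k 1
  have hrot_ne : ∀ (v : Fin n) {k l : ℕ}, k < n → l < n → k ≠ l → rot v k ≠ rot v l :=
    fun v _ _ hk hl hkl h => hkl (rot_inj hk hl h)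
  have hpair : ∀ v, ∃ l r : B.Cluster v, l ≠ r ∧ (∀ a, a = l ∨ a = r) ∧
      B.deg (rot v 1) ⟨v, l⟩ < B.deg (rot v 1) ⟨v, r⟩ ∧
      B.deg (rot v (n - 1)) ⟨v, r⟩ < B.deg (rot v (n - 1)) ⟨v, l⟩ := fun v =>
    (hB.subsingleton_or_pair (hnb v)).resolve_left fun h =>
      hB.not_hasTransversal (hasTransversal_of_subsingleton hn hens B hB.le_density h)
  choose L R hLR hall hrow hcol using hpair
  have hsum : ∀ v (g : B.Cluster v → ℝ), ∑ a, g a = g (L v) + g (R v) := by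
    intro v g
    rw [← Finset.sum_pair (hLR v)]
    refine (Finset.sum_subset (Finset.subset_univ _) fun a _ ha => absurd ?_ ha).symm
    simpa using hall v a
  set p : Fin n → ℝ := fun v => B.weight ⟨v, R v⟩ with hp
  set q : Fin n → ℝ := fun v => B.weight ⟨v, L v⟩ with hq
  have hp0 : ∀ v, 0 < p v := fun v => hB.weight_pos _
  have hq0 : ∀ v, 0 < q v := fun v => hB.weight_pos _
  have hqp : ∀ v, q v + p v = 1 := fun v => by
    rw [← B.sum_weight v, hsum]
  let LL : Fin n → Prop := fun v => B.graph.Adj ⟨v, L v⟩ ⟨rot v 1, L (rot v 1)⟩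
  let LR : Fin n → Prop := fun v => B.graph.Adj ⟨v, L v⟩ ⟨rot v 1, R (rot v 1)⟩
  let RL : Fin n → Prop := fun v => B.graph.Adj ⟨v, R v⟩ ⟨rot v 1, L (rot v 1)⟩
  let RR : Fin n → Prop := fun v => B.graph.Adj ⟨v, R v⟩ ⟨rot v 1, R (rot v 1)⟩
  let d : Fin n → ℝ := fun v => B.density v (rot v 1)
  have hγd : ∀ v, γ s(v, rot v 1) ≤ d v := fun v =>
    hB.le_density _ _ ((cycleGraph_adj_iff hn _ _).2 (Or.inl rfl))
  -- `N` is the parallel type. If its `RL` is missing, the two edges form a matching and the degree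
  -- inequalities compare the weights.
  let N : Fin n → Prop := fun v => LL v ∧ RR v ∧ d v ≤ 1 - q v * p (rot v 1) ∧
    (RL v ∨ (p v < q v ∧ q (rot v 1) < p (rot v 1)))
  -- `T` is the crossing type; without `LR` only the edge `RL` is left, of density `p v * q (rot v
  -- 1)`.
  let T : Fin n → Prop := fun v => d v ≤ 1 - p (rot v 1) ∧ d v ≤ 1 - q v ∧
    (LR v ∨ d v ≤ p v * q (rot v 1))
  have hNT : ∀ v, N v ∨ T v := by
    intro v
    have hdeg : ∀ a : B.Cluster v, B.deg (rot v 1) ⟨v, a⟩ =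
        (if B.graph.Adj ⟨v, a⟩ ⟨rot v 1, L (rot v 1)⟩ then q (rot v 1) else 0) +
        (if B.graph.Adj ⟨v, a⟩ ⟨rot v 1, R (rot v 1)⟩ then p (rot v 1) else 0) :=
      fun a => hsum _ _
    have hdeg' : ∀ b : B.Cluster (rot v 1), B.deg v ⟨rot v 1, b⟩ =
        (if B.graph.Adj ⟨v, L v⟩ ⟨rot v 1, b⟩ then q v else 0) +
        (if B.graph.Adj ⟨v, R v⟩ ⟨rot v 1, b⟩ then p v else 0) := by
      intro b
      refine (hsum v _).trans ?_
      simp only [B.graph.adj_comm ⟨rot v 1, b⟩]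
      rfl
    have h1 := hrow v
    have h2 := hcol (rot v 1)
    rw [hprv, hdeg', hdeg'] at h2
    rw [hdeg, hdeg] at h1
    refine adjacency_cases (LL v) (LR v) (RL v) (RR v) (hp0 v) (hq0 v) (hp0 _) (hq0 _) (hqp _)
      (hqp _) h1 h2 ?_
    change B.density v (rot v 1) = _
    rw [WeightedBlowup.density_eq_sum_deg, hsum, hdeg, hdeg]
  have hd1 : ∀ v, d v ≤ 1 := by
    intro v
    rcases hNT v with h | h
    · linarith [h.2.2.1, mul_pos (hq0 v) (hp0 (rot v 1))]
    · linarith [h.1, hp0 (rot v 1)]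
  have htrans : ∀ φ : ∀ v, B.Cluster v,
      ¬ ∀ v, B.graph.Adj ⟨v, φ v⟩ ⟨rot v 1, φ (rot v 1)⟩ := by
    intro φ hφ
    refine hB.not_hasTransversal ⟨φ, fun u v huv => ?_⟩
    rcases (cycleGraph_adj_iff hn _ _).1 huv with rfl | rfl
    · exact hφ u
    · exact (hφ v).symm
  -- `S` is the set of clusters in which `R` is chosen.
  have hsel : ∀ S : Fin n → Prop, ¬ ∀ v,
      (S v → S (rot v 1) → RR v) ∧ (S v → ¬ S (rot v 1) → RL v) ∧
      (¬ S v → S (rot v 1) → LR v) ∧ (¬ S v → ¬ S (rot v 1) → LL v) := by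
    intro S hS
    refine htrans (fun v => if S v then R v else L v) fun v => ?_
    obtain ⟨h1, h2, h3, h4⟩ := hS v
    by_cases hv : S v <;> by_cases hv' : S (rot v 1) <;> simp only [hv, hv', if_true, if_false]
    · exact h1 hv hv'
    · exact h2 hv hv'
    · exact h3 hv hv'
    · exact h4 hv hv'
  obtain ⟨i, hi⟩ : ∃ i, ¬ N i := by
    by_contra! h
    exact htrans L fun v => (h v).1
  have hTi : T i := (hNT i).resolve_left hi
  by_cases hex : ∃ m, 0 < m ∧ m < n ∧ T (rot i m)
  · obtain ⟨hm0, hmn, hTm⟩ := Nat.find_spec hex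
    have hmin : ∀ k, k < Nat.find hex → ¬ _ := fun k hk => Nat.find_min hex hk
    generalize Nat.find hex = m at hm0 hmn hTm hmin
    have hNk : ∀ k, 0 < k → k < m → N (rot i k) := fun k h0 hk =>
      (hNT _).resolve_right fun h => hmin k hk ⟨h0, by omega, h⟩
    -- Cut at the crossing `i` and keep the weights `q` up to the next crossing `m`. The two bounds
    -- in `T` are what the edges at `0` and `m` need, `N` covers those between, and beyond `m` the
    -- bound is the trivial `1`.
    refine false_of_certificate hn hens i
      (s := fun k => if k = 0 then 1 else if k ≤ m then q (rot i k) else 0) ?_ rfl ?_ ?_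
    · intro k
      have h1 := hq0 (rot i k)
      have h2 := hp0 (rot i k)
      have h3 := hqp (rot i k)
      split_ifs
      · norm_num
      · exact ⟨h1.le, by linarith⟩
      · norm_num
    · rw [if_neg (by omega), if_neg (by omega)]
    · intro k hk
      rw [← hsucc _ k]
      refine (hγd _).trans ?_
      simp only [Nat.add_eq_zero_iff, one_ne_zero, and_false, if_false]
      rcases Nat.eq_zero_or_pos k with rfl | hk0
      · rw [if_pos rfl, if_pos (by omega), rot_zero]
        have h1 := hTi.1
        have h2 := hqp (rot i 1)
        linarith
      rcases lt_trichotomy k m with hkm | rfl | hkm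
      · rw [if_neg (by omega), if_pos hkm.le, if_pos (by omega)]
        have h1 := (hNk k hk0 hkm).2.2.1
        rwa [show 1 - q (rot (rot i k) 1) = p (rot (rot i k) 1) by
          linarith [hqp (rot (rot i k) 1)]]
      · rw [if_neg (by omega), if_pos le_rfl, if_neg (by omega)]
        linarith [hTm.2.1]
      · rw [if_neg (by omega), if_neg (by omega)]
        linarith [hd1 (rot i k)]
  · have hNk : ∀ k, 0 < k → k < n → N (rot i k) := fun k h0 hk =>
      (hNT _).resolve_right fun h => hex ⟨k, h0, hk, h⟩
    have hNv : ∀ v, v ≠ i → N v := by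
      intro v hv
      obtain ⟨k, hk, rfl⟩ := exists_rot i v
      refine hNk k (Nat.pos_of_ne_zero ?_) hk
      rintro rfl
      exact hv (rot_zero i)
    have hinj1 : ∀ v w : Fin n, rot v 1 = rot w 1 → v = w := fun v w h => rot_left_injective 1 h
    have h10 : rot i 1 ≠ i := by
      have := hrot_ne i (k := 1) (l := 0) (by omega) (by omega) (by omega)
      rwa [rot_zero] at this
    have h20 : rot i 2 ≠ i := by
      have := hrot_ne i (k := 2) (l := 0) (by omega) (by omega) (by omega)
      rwa [rot_zero] at this
    have h21 : rot i 2 ≠ rot i 1 := hrot_ne i (by omega) (by omega) (by omega)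
    rcases hTi.2.2 with hLRi | hdi
    · by_cases hRL1 : RL (rot i 1)
      -- Cross from `L` to `R` by `LR` at `i`, and return at once by `RL`.
      · refine hsel (fun v => v = rot i 1) fun v => ⟨?_, ?_, ?_, ?_⟩
        · rintro rfl h
          rw [hsucc] at h
          exact absurd h h21
        · rintro rfl _
          exact hRL1
        · intro _ h
          rw [hinj1 _ _ h]
          exact hLRi
        · intro _ h
          exact (hNv v fun hv => h (by rw [hv])).1
      -- Missing `RL` at `i + 1` forces `q < p` at `i + 2`, whereas missing it at `i + 2` would
      -- force `p < q` there. So the return is possible one step later, and `3 ≤ n` ensures `i + 2 ≠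
      -- i`.
      · have hRL2 : RL (rot i 2) := by
          have h1 := (hNk 1 (by omega) (by omega)).2.2.2.resolve_left hRL1
          have h2 := (hNk 2 (by omega) (by omega)).2.2.2
          rw [hsucc] at h1
          exact h2.resolve_right fun h2 => absurd h1.2 h2.1.asymm
        refine hsel (fun v => v = rot i 1 ∨ v = rot i 2) fun v => ⟨?_, ?_, ?_, ?_⟩
        · rintro (rfl | rfl) _
          · exact (hNv _ h10).2.1
          · exact (hNv _ h20).2.1
        · rintro (rfl | rfl) h
          · exact absurd (Or.inr (hsucc i 1)) h
          · exact hRL2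
        · rintro hv (h | h)
          · rw [hinj1 _ _ h]
            exact hLRi
          · rw [← hsucc i 1] at h
            exact absurd (Or.inl (hinj1 _ _ h)) hv
        · intro _ h
          exact (hNv v fun hv => h (Or.inl (by rw [hv]))).1
    · have hP : ∀ k, 0 < p (rot i k) ∧ p (rot i k) < 1 := fun k =>
        ⟨hp0 _, by linarith [hq0 (rot i k), hqp (rot i k)]⟩
      have hq1 : ∀ v, q v = 1 - p v := fun v => by linarith [hqp v]
      have hdk : ∀ k, 0 < k → k < n →
          d (rot i k) ≤ 1 - (1 - p (rot i k)) * p (rot i (k + 1)) := by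
        intro k h0 hk
        have := (hNk k h0 hk).2.2.1
        rwa [hsucc, hq1] at this
      have hd0 : d i ≤ p (rot i n) * (1 - p (rot i 1)) := by rwa [rot_self, ← hq1]
      -- The product runs over the vertices other than `i` and `i + 1`, the ends of the crossing
      -- edge. If it is at least `1`, cutting at `i + 1` works; otherwise its inverse is at least
      -- `1` and cutting at `i` does.
      rcases le_total 1 (∏ k ∈ Finset.range (n - 2),
        (1 - p (rot i (k + 2))) / p (rot i (k + 2))) with hprod | hprod
      · obtain ⟨s, hs, hs0, hsn, h1, h2⟩ := exists_certificate hn hP hprod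
        refine false_of_certificate hn hens (rot i 1) hs hs0 hsn fun k hk => ?_
        rw [← hsucc _ k]
        refine (hγd _).trans ?_
        rw [rot_rot, Nat.add_comm 1 k]
        rcases Nat.lt_or_ge (k + 1) n with hkn | hkn
        · exact (hdk (k + 1) (by omega) hkn).trans (by linarith [h1 k hkn])
        · obtain rfl : k = n - 1 := by omega
          rw [Nat.sub_add_cancel (by omega), hsn, rot_self]
          linarith
      · obtain ⟨s, hs, hs0, hsn, h1, h2⟩ := exists_certificate_reverse hn hP (by
          rw [← one_le_inv₀ (Finset.prod_pos fun k _ => by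
            exact div_pos (by linarith [hP (k + 2)]) (hP (k + 2)).1), ← Finset.prod_inv_distrib]
            at hprod
          simpa only [inv_div] using hprod)
        refine false_of_certificate hn hens i hs hs0 hsn fun k hk => ?_
        rw [← hsucc _ k]
        refine (hγd _).trans ?_
        rcases Nat.eq_zero_or_pos k with rfl | hk0
        · rw [rot_zero, hs0, zero_add]
          linarith
        · exact (hdk k hk0 hk).trans (by linarith [h1 k hk0 hk])

end DensityTuran

theorem theorem5p8 (n : ℕ) (hn : 3 ≤ n) :
    DensityTuran.GeneralStarDecomposition (SimpleGraph.cycleGraph n) ∧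
      ∀ f : Fin n ≃ Fin n, DensityTuran.IsProperLabeling (SimpleGraph.cycleGraph n) f →
        Nonempty (DensityTuran.monotonePathTree (SimpleGraph.cycleGraph n) f ≃g
          SimpleGraph.pathGraph (n + 1)) := by
  refine ⟨DensityTuran.generalStarDecomposition_cycleGraph hn, fun f hf => ?_⟩
  obtain ⟨e, -⟩ := hf.exists_iso hn (v := f ⟨n - 1, by omega⟩) (by rw [f.symm_apply_apply])
  exact ⟨e.symm⟩
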